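/- Let $G$ be a finite graph (parallel edges and loops allowed, not necessarily connected) with vertex set $V$ and set of directed edges $\vec E$ (each edge taken in both directions), let $w:\vec E\to\mathbb Z$ be a skew-symmetric weight function, i.e. $w(\bar d)=-w(d)$ where $\bar d$ is the reversal of $d$. Let a planar embedding of $G$ be given, in combinatorial form: for every vertex the counterclockwise cyclic order of the directed edges leaving it; a finite set $F$ of faces, the face on the right-hand side of every directed edge $d$ being the same as that on the right-hand side of its successor along the face (the directed edge that follows $\bar d$ counterclockwise around the end of $d$); such that the dual graph is connected and Euler's formula $|V|-|E|+|F|=1+c$ holds, $c$ being the number of connected components of $G$; and a distinguished outer face. The circulation of an oriented cycle (which repeats no vertex and uses no edge in both directions) is the sum of the weights of its directed edges. The circulation of a face $f$ is the sum of $w(d)$ over all directed edges $d$ having $f$ on their right-hand side, that is, over the boundary of $f$ traversed with $f$ on the right (clockwise, for an inner face). A face is inside a cycle $C$ if it cannot be reached from the outer face by passing from face to face across edges not on $C$. An oriented cycle is clockwise if for each of its directed edges the face on the right-hand side is inside the cycle. Then for every cycle exactly one of its two orientations is clockwise, and the circulation of any clockwise oriented cycle $C$ is the sum of the circulations of the faces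 inside $C$: $$\sum_{d\in C} w(d)=\sum_{f\text{ inside }C}\ \sum_{d:\ f\text{ is to the right of }d} w(d).$$ -/

import Mathlib

/-- A graph with vertex set `V`, given by its set `D` of directed edges (the set `E` with both
directions of every edge): each directed edge has an initial vertex and a reversal. Parallel edges
(and loops) are allowed. A simple graph `H` is the case `D = H.Dart`. -/
structure DartGraph (V D : Type*) where
  src : D → V
  rev : D → D
  rev_rev : ∀ d, rev (rev d) = d
  rev_ne : ∀ d, rev d ≠ d

namespace DartGraph

variable {V D F : Type*}

/-- The end vertex of a directed edge. -/
def tgt (G : DartGraph V D) (d : D) : V := G.src (G.rev d)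

/-- The connected components: `V` modulo the equivalence relation generated by adjacency. -/
def Components (G : DartGraph V D) : Type _ :=
  Quot fun u v : V => ∃ d, G.src d = u ∧ G.tgt d = v

/-- Skew-symmetric weight functions, `w(u,v) = -w(v,u)`. -/
def SkewSymmetric (G : DartGraph V D) (w : D → ℤ) : Prop := ∀ d, w (G.rev d) = -w d

/-- A cycle with an orientation: directed edges `dart 0, …, dart n`, each ending where the next one
begins (indices are cyclic, as addition in `Fin (n + 1)` is modulo `n + 1`), which visits no vertex
twice and does not use an edge in both directions. -/
structure OrientedCycle (G : DartGraph V D) where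
  n : ℕ
  dart : Fin (n + 1) → D
  tgt_dart : ∀ i, G.tgt (dart i) = G.src (dart (i + 1))
  src_injective : Function.Injective fun i => G.src (dart i)
  dart_ne_rev : ∀ i j, dart i ≠ G.rev (dart j)

namespace OrientedCycle

variable {G : DartGraph V D}

/-- The same cycle with the opposite orientation. -/
def reverse (C : G.OrientedCycle) : G.OrientedCycle where
  n := C.n
  dart i := G.rev (C.dart (-i))
  tgt_dart i := by
    have h := C.tgt_dart (-(i + 1))
    have e : -(i + 1) + 1 = -i := by abel
    rw [e] at h
    change G.src (G.rev (G.rev (C.dart (-i)))) = G.tgt (C.dart (-(i + 1)))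
    rw [G.rev_rev, h]
  src_injective := by
    intro i j hij
    have h : G.tgt (C.dart (-i)) = G.tgt (C.dart (-j)) := hij
    rw [C.tgt_dart, C.tgt_dart] at h
    exact neg_injective (add_right_cancel (C.src_injective h))
  dart_ne_rev i j h := by
    rw [G.rev_rev] at h
    exact C.dart_ne_rev (-j) (-i) h.symm

/-- The circulation `w(v₁,v₂) + w(v₂,v₃) + ⋯ + w(vₖ,v₁)`. -/
def circulation (C : G.OrientedCycle) (w : D → ℤ) : ℤ := ∑ i, w (C.dart i)

/-- The directed edge `d`, or its reversal, is used by the cycle. -/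
def Uses (C : G.OrientedCycle) (d : D) : Prop := ∃ i, C.dart i = d ∨ C.dart i = G.rev d

end OrientedCycle

/-- A (combinatorial) planar embedding of a graph, with set of faces `F`.

* `rot` is the rotation system: it sends a directed edge to the next one, in counterclockwise order,
  among the directed edges with the same initial vertex.
* `right d` is the face on the right-hand side of `d`. Walking along `d` with that face at the right
  hand, the next directed edge of its boundary is `rot (rev d)`. So a face is bounded by one orbit
  of `d ↦ rot (rev d)`, or by several orbits where components of the graph lie in different places
  of the same face; `connected` and `euler` together say that the surface so obtained is one
  sphere. If the graph is connected they force the faces to be exactly the orbits (or there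
  is no edge and a single face), and `euler` is then the usual `|V| - |E| + |F| = 2`.
* `outer` is the outer (unbounded) face of the drawing. -/
structure PlanarEmbedding (G : DartGraph V D) (F : Type*) where
  rot : Equiv.Perm D
  src_rot : ∀ d, G.src (rot d) = G.src d
  rot_sameCycle : ∀ d e, G.src d = G.src e → rot.SameCycle d e
  right : D → F
  right_next : ∀ d, right (rot (G.rev d)) = right d
  outer : F
  /-- The dual graph is connected. -/
  connected : ∀ f, Relation.ReflTransGen
    (fun g g' => ∃ d, right d = g ∧ right (G.rev d) = g') outer f
  /-- Euler's formula `|V| - |E| + |F| = 1 + #components`, doubled; `|D| = 2 |E|`. -/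
  euler : 2 * (Nat.card V + Nat.card F) = Nat.card D + 2 * (1 + Nat.card G.Components)

namespace PlanarEmbedding

variable {G : DartGraph V D}

/-- A face lies inside a cycle if it cannot be reached from the outer face by passing from face to
face across edges that are not on the cycle. -/
def Inside (E : G.PlanarEmbedding F) (C : G.OrientedCycle) (f : F) : Prop :=
  ¬ Relation.ReflTransGen
    (fun g g' => ∃ d, ¬ C.Uses d ∧ E.right d = g ∧ E.right (G.rev d) = g') E.outer f

/-- A cycle is oriented clockwise if its inside is on the right-hand side of all its edges. -/
def IsClockwise (E : G.PlanarEmbedding F) (C : G.OrientedCycle) : Prop :=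
  ∀ i, E.Inside C (E.right (C.dart i))

open Classical in
/-- The circulation of a face: the sum of the weights along its boundary, traversed with the face on
the right-hand side (clockwise, for an inner face). -/
noncomputable def faceCirculation [Fintype D] (E : G.PlanarEmbedding F) (w : D → ℤ) (f : F) : ℤ :=
  ∑ d : D with E.right d = f, w d

open Classical in
/-- The set of the faces inside a cycle. -/
noncomputable def facesInside [Fintype F] (E : G.PlanarEmbedding F) (C : G.OrientedCycle) :
    Finset F :=
  Finset.univ.filter fun f => E.Inside C f

end PlanarEmbedding

end DartGraph

/-! The heart is a combinatorial Jordan curve theorem, obtained from rational homology. Coboundaries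
of functions on `V` and boundaries of functions on `F` are orthogonal, so a vanishing sum has both
terms zero; connectedness of the dual graph then bounds the kernel of `hodgeMap` by c + 1, and
Euler's formula makes it surjective (`hodgeMap_surjective`). A cycle is orthogonal to all
coboundaries, hence is a pure boundary (`exists_potential`).

Applied to an oriented cycle, this gives a function on faces that jumps by 1 across the cycle and
nowhere else, so its two sides are separated (`not_joined_left_right`). Turning around its vertices
shows that each side is in one piece, and dual connectivity that there is no third piece. Exactly
one side therefore contains the outer face. For a clockwise cycle the indicator of the inside has
the cycle as boundary; pairing with `w` gives the formula. -/

namespace DartGraph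

variable {V D F : Type*}

/-- Reversal of directed edges as a permutation. -/
def revEquiv (G : DartGraph V D) : Equiv.Perm D where
  toFun := G.rev
  invFun := G.rev
  left_inv := G.rev_rev
  right_inv := G.rev_rev

theorem tgt_rev (G : DartGraph V D) (d : D) : G.tgt (G.rev d) = G.src d := by
  rw [tgt, G.rev_rev]

theorem sum_comp_rev [Fintype D] {M : Type*} [AddCommMonoid M] (G : DartGraph V D) (φ : D → M) :
    ∑ d, φ (G.rev d) = ∑ d, φ d :=
  Equiv.sum_comp G.revEquiv φ

/-- Summation by parts: pairing a coboundary with a skew-symmetric function. -/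
theorem sum_coboundary_mul [Fintype D] (G : DartGraph V D) (p : V → ℚ) (h : D → ℚ)
    (hh : ∀ d, h (G.rev d) = -h d) :
    ∑ d, (p (G.tgt d) - p (G.src d)) * h d = -2 * ∑ d, p (G.src d) * h d := by
  have e : ∑ d, p (G.tgt d) * h d = -∑ d, p (G.src d) * h d := by
    rw [← G.sum_comp_rev, ← Finset.sum_neg_distrib]
    exact Finset.sum_congr rfl fun d _ => by rw [tgt_rev, hh, mul_neg]
  simp only [sub_mul, Finset.sum_sub_distrib, e]
  ring

/-- An orientation contains one half of the directed edges. -/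
theorem exists_orientation [Fintype D] (G : DartGraph V D) :
    ∃ P : Finset D, 2 * P.card = Fintype.card D ∧ ∀ d, d ∈ P ∨ G.rev d ∈ P := by
  classical
  -- An arbitrary linear order selects the smaller of `d` and its reversal.
  obtain ⟨o⟩ : Nonempty (LinearOrder D) := ⟨linearOrderOfSTO WellOrderingRel⟩
  let P : Finset D := Finset.univ.filter fun d => d < G.rev d
  refine ⟨P, ?_, fun d => ?_⟩
  · have h : P.card = Pᶜ.card := by
      refine Finset.card_bij (fun d _ => G.rev d) ?_ ?_ ?_
      · intro d hd
        simp only [P, Finset.mem_filter, Finset.mem_univ, true_and, Finset.mem_compl,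
          G.rev_rev, not_lt] at hd ⊢
        exact hd.le
      · intro d _ e _ hde
        exact G.revEquiv.injective hde
      · intro d hd
        simp only [P, Finset.mem_filter, Finset.mem_univ, true_and, Finset.mem_compl,
          not_lt] at hd
        refine ⟨G.rev d, ?_, G.rev_rev d⟩
        simp only [P, Finset.mem_filter, Finset.mem_univ, true_and, G.rev_rev]
        exact lt_of_le_of_ne hd (G.rev_ne d)
    have := P.card_add_card_compl
    omega
  · simp only [P, Finset.mem_filter, Finset.mem_univ, true_and, G.rev_rev]
    exact lt_or_gt_of_ne (G.rev_ne d).symm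

/-! ### Vanishing of the first homology -/

namespace PlanarEmbedding

variable {G : DartGraph V D}

theorem right_rot (E : G.PlanarEmbedding F) (d : D) : E.right (E.rot d) = E.right (G.rev d) := by
  rw [← E.right_next (G.rev d), G.rev_rev]

/-- The boundary of a 2-chain is a cycle. -/
theorem sum_src_mul_boundary [Fintype D] (E : G.PlanarEmbedding F) (p : V → ℚ) (g : F → ℚ) :
    ∑ d, p (G.src d) * (g (E.right d) - g (E.right (G.rev d))) = 0 := by
  have e : ∑ d, p (G.src d) * g (E.right (G.rev d)) = ∑ d, p (G.src d) * g (E.right d) := by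
    -- Rotation keeps the initial vertex and carries the left face of `d` to the right face of `rot
    -- d`.
    rw [← Equiv.sum_comp E.rot (fun d => p (G.src d) * g (E.right d))]
    exact Finset.sum_congr rfl fun d _ => by rw [E.src_rot, E.right_rot]
  simp only [mul_sub, Finset.sum_sub_distrib, e, sub_self]

theorem sum_coboundary_mul_boundary [Fintype D] (E : G.PlanarEmbedding F) (p : V → ℚ)
    (g : F → ℚ) :
    ∑ d, (p (G.tgt d) - p (G.src d)) * (g (E.right d) - g (E.right (G.rev d))) = 0 := by
  rw [G.sum_coboundary_mul p (fun d => g (E.right d) - g (E.right (G.rev d)))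
    (fun d => by rw [G.rev_rev]; ring), E.sum_src_mul_boundary, mul_zero]

/-- A function on the faces which does not change across edges is constant. -/
theorem eq_outer_of_forall_right_eq (E : G.PlanarEmbedding F) {α : Type*} (g : F → α)
    (hg : ∀ d, g (E.right d) = g (E.right (G.rev d))) (f : F) : g f = g E.outer := by
  induction E.connected f with
  | refl => rfl
  | tail _ h ih =>
    obtain ⟨d, rfl, rfl⟩ := h
    rw [← hg, ih]

/-- The sum of the coboundary of a function on the vertices and the boundary of a function on the
faces, evaluated on a set of directed edges. -/
def hodgeMap (E : G.PlanarEmbedding F) (P : Finset D) :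
    ((V → ℚ) × (F → ℚ)) →ₗ[ℚ] (P → ℚ) where
  toFun x d := (x.1 (G.tgt d) - x.1 (G.src d)) + (x.2 (E.right d) - x.2 (E.right (G.rev d)))
  map_add' x y := by
    funext d
    simp only [Prod.fst_add, Prod.snd_add, Pi.add_apply]
    ring
  map_smul' c x := by
    funext d
    simp only [Prod.smul_fst, Prod.smul_snd, Pi.smul_apply, smul_eq_mul, RingHom.id_apply]
    ring

/-- Functions constant on the components, together with constant functions on the faces. -/
def constantMap (G : DartGraph V D) (F : Type*) :
    ((G.Components → ℚ) × ℚ) →ₗ[ℚ] ((V → ℚ) × (F → ℚ)) where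
  toFun y := (fun v => y.1 (Quot.mk _ v), fun _ => y.2)
  map_add' _ _ := rfl
  map_smul' _ _ := rfl

/-- A skew-symmetric function with vanishing values on an orientation vanishes. -/
theorem forall_of_orientation {P : Finset D} (hP : ∀ d, d ∈ P ∨ G.rev d ∈ P) {h k : D → ℚ}
    (hh : ∀ d, h (G.rev d) = -h d) (hk : ∀ d, k (G.rev d) = -k d)
    (e : ∀ d ∈ P, h d = k d) (d : D) : h d = k d := by
  rcases hP d with hd | hd
  · exact e d hd
  · have := e _ hd
    rwa [hh, hk, neg_inj] at this

theorem hodge_skew (E : G.PlanarEmbedding F) (p : V → ℚ) (g : F → ℚ) (d : D) :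
    (p (G.tgt (G.rev d)) - p (G.src (G.rev d))) +
        (g (E.right (G.rev d)) - g (E.right (G.rev (G.rev d)))) =
      -((p (G.tgt d) - p (G.src d)) + (g (E.right d) - g (E.right (G.rev d)))) := by
  rw [tgt_rev, G.rev_rev]
  change p (G.src d) - p (G.tgt d) + _ = _
  ring

/-- If a coboundary and a boundary cancel, orthogonality makes the sum of squares of the coboundary
vanish, so both are zero. -/
theorem ker_hodgeMap_le [Fintype D] (E : G.PlanarEmbedding F) {P : Finset D}
    (hP : ∀ d, d ∈ P ∨ G.rev d ∈ P) :
    LinearMap.ker (E.hodgeMap P) ≤ LinearMap.range (constantMap G F) := by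
  rintro ⟨p, g⟩ hx
  have h0 : ∀ d, (p (G.tgt d) - p (G.src d)) + (g (E.right d) - g (E.right (G.rev d))) = 0 :=
    forall_of_orientation hP (k := fun _ => 0) (E.hodge_skew p g) (fun _ => neg_zero.symm)
      fun d hd => congrFun (LinearMap.mem_ker.mp hx) ⟨d, hd⟩
  have hs : ∑ d, (p (G.tgt d) - p (G.src d)) * (p (G.tgt d) - p (G.src d)) = 0 := by
    rw [← neg_eq_zero, ← E.sum_coboundary_mul_boundary p g, ← Finset.sum_neg_distrib]
    exact Finset.sum_congr rfl fun d _ => by rw [← mul_neg, eq_neg_of_add_eq_zero_left (h0 d),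
      neg_neg]
  have hp : ∀ d, p (G.tgt d) - p (G.src d) = 0 := fun d =>
    mul_self_eq_zero.mp <|
      (Finset.sum_eq_zero_iff_of_nonneg fun d _ => mul_self_nonneg _).mp hs d (Finset.mem_univ d)
  have hg : ∀ d, g (E.right d) = g (E.right (G.rev d)) := fun d => by
    have := h0 d
    rw [hp d, zero_add] at this
    exact sub_eq_zero.mp this
  refine ⟨(Quot.lift p ?_, g E.outer), ?_⟩
  · rintro u v ⟨d, rfl, rfl⟩
    exact (sub_eq_zero.mp (hp d)).symm
  · exact Prod.ext rfl (funext fun f => (E.eq_outer_of_forall_right_eq g hg f).symm)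

/-- By Euler's formula, every function on an orientation is the sum of a coboundary and a
boundary. -/
theorem hodgeMap_surjective [Fintype V] [Fintype D] [Fintype F] (E : G.PlanarEmbedding F)
    {P : Finset D} (hc : 2 * P.card = Fintype.card D) (hP : ∀ d, d ∈ P ∨ G.rev d ∈ P) :
    Function.Surjective (E.hodgeMap P) := by
  have : Finite G.Components := Quot.finite _
  let : Fintype G.Components := Fintype.ofFinite _
  have h1 := Submodule.finrank_mono (E.ker_hodgeMap_le hP)
  have h2 := LinearMap.finrank_range_le (constantMap G F)
  have h3 := LinearMap.finrank_range_add_finrank_ker (E.hodgeMap P)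
  have he := E.euler
  rw [Module.finrank_prod, Module.finrank_fintype_fun_eq_card] at h2 h3
  rw [Module.finrank_fintype_fun_eq_card] at h3
  rw [Module.finrank_self] at h2
  simp only [Nat.card_eq_fintype_card] at he
  rw [← LinearMap.range_eq_top]
  apply Submodule.eq_top_of_finrank_eq
  apply le_antisymm (Submodule.finrank_le _)
  rw [Module.finrank_fintype_fun_eq_card, Fintype.card_coe]
  -- The kernel has dimension at most c + 1, so the rank is at least |V| + |F| - c - 1, which is |E|
  -- by Euler's formula.
  omega

/-- On the sphere every cycle (in the homological sense) is a boundary. -/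
theorem exists_potential [Fintype V] [Fintype D] [Fintype F] (E : G.PlanarEmbedding F)
    (h : D → ℚ) (hskew : ∀ d, h (G.rev d) = -h d)
    (hcycle : ∀ p : V → ℚ, ∑ d, p (G.src d) * h d = 0) :
    ∃ g : F → ℚ, ∀ d, g (E.right d) - g (E.right (G.rev d)) = h d := by
  obtain ⟨P, hc, hP⟩ := G.exists_orientation
  obtain ⟨⟨p, g⟩, hpg⟩ := E.hodgeMap_surjective hc hP fun d => h d
  have h0 : ∀ d, (p (G.tgt d) - p (G.src d)) + (g (E.right d) - g (E.right (G.rev d))) = h d :=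
    forall_of_orientation hP (E.hodge_skew p g) hskew fun d hd => congrFun hpg ⟨d, hd⟩
  have hs : ∑ d, (p (G.tgt d) - p (G.src d)) * (p (G.tgt d) - p (G.src d)) = 0 := by
    have e1 := E.sum_coboundary_mul_boundary p g
    have e2 := G.sum_coboundary_mul p h hskew
    rw [hcycle, mul_zero] at e2
    -- The coboundary part is orthogonal both to `h` and to the boundary part, hence to itself.
    rw [← e2, ← add_zero (∑ d, _), ← e1, ← Finset.sum_add_distrib]
    exact Finset.sum_congr rfl fun d _ => by rw [← mul_add, h0]
  refine ⟨g, fun d => ?_⟩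
  have hp : p (G.tgt d) - p (G.src d) = 0 :=
    mul_self_eq_zero.mp <|
      (Finset.sum_eq_zero_iff_of_nonneg fun d _ => mul_self_nonneg _).mp hs d (Finset.mem_univ d)
  rw [← h0 d, hp, zero_add]

end PlanarEmbedding

/-! ### Oriented cycles as 1-chains -/

namespace OrientedCycle

variable {G : DartGraph V D}

theorem dart_injective (C : G.OrientedCycle) : Function.Injective C.dart := fun _ _ h =>
  C.src_injective (congrArg G.src h)

theorem uses_rev (C : G.OrientedCycle) (d : D) : C.Uses (G.rev d) ↔ C.Uses d := by
  simp only [Uses, G.rev_rev, or_comm]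

theorem uses_reverse (C : G.OrientedCycle) (d : D) : C.reverse.Uses d ↔ C.Uses d := by
  have key : ∀ (C : G.OrientedCycle) d, C.Uses d → C.reverse.Uses d := by
    rintro C d ⟨i, h⟩
    refine ⟨-i, ?_⟩
    change G.rev (C.dart (- -i)) = _ ∨ G.rev (C.dart (- -i)) = _
    rw [neg_neg]
    rcases h with h | h
    · exact Or.inr (by rw [h])
    · exact Or.inl (by rw [h, G.rev_rev])
  refine ⟨?_, key C d⟩
  rintro ⟨i, h⟩
  change G.rev (C.dart (-i)) = _ ∨ G.rev (C.dart (-i)) = _ at h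
  refine ⟨-i, ?_⟩
  rcases h with h | h
  · exact Or.inr (by rw [← h, G.rev_rev])
  · exact Or.inl (G.revEquiv.injective h)

open Classical in
/-- The cycle as a skew-symmetric function on the directed edges. -/
noncomputable def chain (C : G.OrientedCycle) (d : D) : ℤ :=
  ∑ i, ((if d = C.dart i then 1 else 0) - (if d = G.rev (C.dart i) then 1 else 0))

theorem chain_rev (C : G.OrientedCycle) (d : D) : C.chain (G.rev d) = -C.chain d := by
  have e1 : ∀ i, G.rev d = C.dart i ↔ d = G.rev (C.dart i) := fun i =>
    ⟨fun h => by rw [← h, G.rev_rev], fun h => by rw [h, G.rev_rev]⟩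
  have e2 : ∀ i, G.rev d = G.rev (C.dart i) ↔ d = C.dart i := fun i =>
    G.revEquiv.injective.eq_iff
  classical
  rw [chain, chain, ← Finset.sum_neg_distrib]
  exact Finset.sum_congr rfl fun i _ => by
    rw [if_congr (e1 i) rfl rfl, if_congr (e2 i) rfl rfl, neg_sub]

theorem chain_dart (C : G.OrientedCycle) (i : Fin (C.n + 1)) : C.chain (C.dart i) = 1 := by
  simp only [chain, C.dart_injective.eq_iff, C.dart_ne_rev, if_false, sub_zero,
    Finset.sum_ite_eq, Finset.mem_univ, if_true]

theorem chain_of_not_uses (C : G.OrientedCycle) {d : D} (hd : ¬ C.Uses d) : C.chain d = 0 := by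
  refine Finset.sum_eq_zero fun i _ => ?_
  rw [if_neg fun h => hd ⟨i, Or.inl h.symm⟩,
    if_neg fun h => hd ⟨i, Or.inr (by rw [h, G.rev_rev])⟩, sub_zero]

theorem sum_mul_chain [Fintype D] {R : Type*} [CommRing R] (C : G.OrientedCycle) (φ : D → R) :
    ∑ d, φ d * (C.chain d : R) = ∑ i, (φ (C.dart i) - φ (G.rev (C.dart i))) := by
  classical
  simp only [chain, Int.cast_sum, Finset.mul_sum]
  rw [Finset.sum_comm]
  refine Finset.sum_congr rfl fun i _ => ?_
  simp [mul_sub, Finset.sum_sub_distrib]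

theorem sum_src_mul_chain [Fintype D] (C : G.OrientedCycle) (p : V → ℚ) :
    ∑ d, p (G.src d) * (C.chain d : ℚ) = 0 := by
  rw [C.sum_mul_chain fun d => p (G.src d), Finset.sum_sub_distrib, sub_eq_zero,
    ← Equiv.sum_comp (Equiv.addRight (1 : Fin (C.n + 1)))]
  exact Finset.sum_congr rfl fun i _ => congrArg p (C.tgt_dart i).symm

/-- The directed edges of the cycle leaving the end of `dart i` are `dart (i + 1)` and the reversal
of `dart i`. -/
theorem eq_of_uses_of_src (C : G.OrientedCycle) {d : D} (hd : C.Uses d) {i : Fin (C.n + 1)}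
    (hs : G.src d = G.tgt (C.dart i)) : d = C.dart (i + 1) ∨ d = G.rev (C.dart i) := by
  obtain ⟨j, rfl | h⟩ := hd
  · exact Or.inl (congrArg C.dart (C.src_injective (hs.trans (C.tgt_dart i))))
  · right
    have hj : G.src d = G.tgt (C.dart j) := by rw [h, tgt_rev]
    rw [hs, C.tgt_dart, C.tgt_dart] at hj
    rw [add_right_cancel (C.src_injective hj), h, G.rev_rev]

end OrientedCycle

/-! ### The two sides of a cycle -/

namespace PlanarEmbedding

variable {G : DartGraph V D}

/-- Two faces are joined if one can pass from one to the other without crossing the cycle. -/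
def Joined (E : G.PlanarEmbedding F) (C : G.OrientedCycle) : F → F → Prop :=
  Relation.ReflTransGen fun g g' => ∃ d, ¬ C.Uses d ∧ E.right d = g ∧ E.right (G.rev d) = g'

theorem Joined.trans {E : G.PlanarEmbedding F} {C : G.OrientedCycle} {f g h : F}
    (h1 : E.Joined C f g) (h2 : E.Joined C g h) : E.Joined C f h :=
  Relation.ReflTransGen.trans h1 h2

theorem Joined.symm {E : G.PlanarEmbedding F} {C : G.OrientedCycle} {f g : F}
    (h : E.Joined C f g) : E.Joined C g f := by
  induction h with
  | refl => exact Relation.ReflTransGen.refl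
  | tail _ h ih =>
    obtain ⟨d, hd, rfl, rfl⟩ := h
    exact Relation.ReflTransGen.head
      ⟨G.rev d, (C.uses_rev d).not.mpr hd, rfl, by rw [G.rev_rev]⟩ ih

theorem joined_of_not_uses (E : G.PlanarEmbedding F) {C : G.OrientedCycle} {d : D}
    (hd : ¬ C.Uses d) : E.Joined C (E.right d) (E.right (G.rev d)) :=
  Relation.ReflTransGen.single ⟨d, hd, rfl, rfl⟩

theorem joined_reverse (E : G.PlanarEmbedding F) (C : G.OrientedCycle) :
    E.Joined C.reverse = E.Joined C := by
  simp only [Joined, C.uses_reverse]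

/-- Turning around the end of an edge of the cycle, one gets to the next edge without crossing the
cycle. -/
theorem joined_right_succ [Finite D] (E : G.PlanarEmbedding F) (C : G.OrientedCycle)
    (i : Fin (C.n + 1)) : E.Joined C (E.right (C.dart i)) (E.right (C.dart (i + 1))) := by
  classical
  set x := G.rev (C.dart i) with hx
  have hne : C.dart (i + 1) ≠ x := C.dart_ne_rev _ _
  have hex : ∃ k : ℕ, (E.rot ^ k) x = C.dart (i + 1) :=
    let ⟨k, _, hk⟩ := (E.rot_sameCycle x _ (C.tgt_dart i)).exists_pow_eq'
    ⟨k, hk⟩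
  have hsrc : ∀ k : ℕ, G.src ((E.rot ^ k) x) = G.tgt (C.dart i) := by
    intro k
    induction k with
    | zero => rfl
    | succ k ih => rw [pow_succ', Equiv.Perm.mul_apply, E.src_rot, ih]
  -- Rotate from `x` until `dart (i + 1)` is first met; no edge of the cycle is crossed before.
  have key : ∀ k : ℕ, k < Nat.find hex →
      E.Joined C (E.right (C.dart i)) (E.right ((E.rot ^ (k + 1)) x)) := by
    intro k
    induction k with
    | zero =>
      intro _
      rw [zero_add, pow_one, hx, E.right_next]
      exact Relation.ReflTransGen.refl
    | succ k ih =>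
      intro hk
      refine (ih (by omega)).trans ?_
      rw [pow_succ' _ (k + 1), Equiv.Perm.mul_apply, E.right_rot]
      refine E.joined_of_not_uses fun hu => ?_
      rcases C.eq_of_uses_of_src hu (hsrc _) with h | h
      · exact Nat.find_min hex hk h
      -- A return to `x` would mean that `dart (i + 1)` was already met `k + 1` steps earlier.
      · refine Nat.find_min hex (m := Nat.find hex - (k + 1)) (by omega) ?_
        have hf := Nat.find_spec hex
        rwa [← Nat.sub_add_cancel hk.le, pow_add, Equiv.Perm.mul_apply, h] at hf
  have hpos : 0 < Nat.find hex := by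
    refine (Nat.find_pos hex).mpr fun h => hne ?_
    rw [← h, pow_zero, Equiv.Perm.one_apply]
  have := key (Nat.find hex - 1) (by omega)
  rwa [Nat.sub_add_cancel hpos, Nat.find_spec hex] at this

theorem joined_right [Finite D] (E : G.PlanarEmbedding F) (C : G.OrientedCycle)
    (i : Fin (C.n + 1)) : E.Joined C (E.right (C.dart 0)) (E.right (C.dart i)) := by
  induction i using Fin.induction with
  | zero => exact Relation.ReflTransGen.refl
  | succ i ih =>
    rw [← Fin.coeSucc_eq_succ]
    exact ih.trans (E.joined_right_succ C _)

theorem joined_left [Finite D] (E : G.PlanarEmbedding F) (C : G.OrientedCycle)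
    (i : Fin (C.n + 1)) :
    E.Joined C (E.right (G.rev (C.dart 0))) (E.right (G.rev (C.dart i))) := by
  have h := E.joined_right C.reverse (-i)
  rw [E.joined_reverse] at h
  change E.Joined C (E.right (G.rev (C.dart (-0)))) (E.right (G.rev (C.dart (- -i)))) at h
  rwa [neg_zero, neg_neg] at h

/-- The two sides of a cycle are separated. -/
theorem not_joined_left_right [Fintype V] [Fintype D] [Fintype F] (E : G.PlanarEmbedding F)
    (C : G.OrientedCycle) (i : Fin (C.n + 1)) :
    ¬ E.Joined C (E.right (G.rev (C.dart i))) (E.right (C.dart i)) := by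
  obtain ⟨g, hg⟩ := E.exists_potential (fun d => (C.chain d : ℚ))
    (fun d => by rw [C.chain_rev, Int.cast_neg]) C.sum_src_mul_chain
  have hconst : ∀ f f', E.Joined C f f' → g f = g f' := by
    intro f f' h
    induction h with
    | refl => rfl
    | tail _ h ih =>
      obtain ⟨d, hd, rfl, rfl⟩ := h
      have := hg d
      rw [C.chain_of_not_uses hd, Int.cast_zero] at this
      exact ih.trans (sub_eq_zero.mp this)
  intro h
  have := hg (C.dart i)
  rw [hconst _ _ h, C.chain_dart, sub_self, Int.cast_one] at this
  exact zero_ne_one this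

/-- Every face lies on one of the two sides of a cycle. -/
theorem joined_right_or_joined_left [Finite D] (E : G.PlanarEmbedding F) (C : G.OrientedCycle)
    (f : F) :
    E.Joined C (E.right (C.dart 0)) f ∨ E.Joined C (E.right (G.rev (C.dart 0))) f := by
  let S : F → Prop := fun f =>
    E.Joined C (E.right (C.dart 0)) f ∨ E.Joined C (E.right (G.rev (C.dart 0))) f
  have hS : ∀ d, S (E.right d) → S (E.right (G.rev d)) := by
    intro d h
    by_cases hd : C.Uses d
    · obtain ⟨i, rfl | h⟩ := hd
      · exact Or.inr (E.joined_left C i)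
      · exact Or.inl (h ▸ E.joined_right C i)
    · exact h.imp (fun h => h.trans (E.joined_of_not_uses hd))
        (fun h => h.trans (E.joined_of_not_uses hd))
  have hS' : ∀ d, S (E.right d) = S (E.right (G.rev d)) := fun d => propext
    ⟨hS d, fun h => by simpa only [G.rev_rev] using hS (G.rev d) h⟩
  -- `S` is constant on faces and holds at one of them.
  have h0 : S (E.right (C.dart 0)) := Or.inl Relation.ReflTransGen.refl
  rw [E.eq_outer_of_forall_right_eq S hS'] at h0
  change S f
  rwa [E.eq_outer_of_forall_right_eq S hS']

theorem isClockwise_iff [Finite D] (E : G.PlanarEmbedding F) (C : G.OrientedCycle) :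
    E.IsClockwise C ↔ ¬ E.Joined C E.outer (E.right (C.dart 0)) :=
  ⟨fun h => h 0, fun h i hi => h (Joined.trans hi (E.joined_right C i).symm)⟩

theorem isClockwise_reverse_iff [Finite D] (E : G.PlanarEmbedding F) (C : G.OrientedCycle) :
    E.IsClockwise C.reverse ↔ ¬ E.Joined C E.outer (E.right (G.rev (C.dart 0))) := by
  have e : C.reverse.dart 0 = G.rev (C.dart 0) := congrArg (fun i => G.rev (C.dart i)) neg_zero
  rw [isClockwise_iff, joined_reverse, e]

/-- Exactly one side of a cycle is joined to the outer face. -/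
theorem joined_outer_left_iff [Fintype V] [Fintype D] [Fintype F] (E : G.PlanarEmbedding F)
    (C : G.OrientedCycle) :
    E.Joined C E.outer (E.right (G.rev (C.dart 0))) ↔
      ¬ E.Joined C E.outer (E.right (C.dart 0)) :=
  ⟨fun hl hr => E.not_joined_left_right C 0 (hl.symm.trans hr), fun h =>
    ((E.joined_right_or_joined_left C E.outer).resolve_left fun hr => h hr.symm).symm⟩

/-! ### The circulation formula -/

open Classical in
/-- The indicator function of the inside of a clockwise cycle has the cycle as its boundary. -/
theorem indicator_inside_sub [Fintype V] [Fintype D] [Fintype F] (E : G.PlanarEmbedding F)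
    (C : G.OrientedCycle) (hC : E.IsClockwise C) (d : D) :
    ((if E.Inside C (E.right d) then 1 else 0) -
      (if E.Inside C (E.right (G.rev d)) then 1 else 0) : ℤ) = C.chain d := by
  have hdart : ∀ i, E.Inside C (E.right (C.dart i)) ∧
      ¬ E.Inside C (E.right (G.rev (C.dart i))) := fun i =>
    ⟨hC i, not_not_intro (((E.joined_outer_left_iff C).mpr ((E.isClockwise_iff C).mp hC)).trans
      (E.joined_left C i))⟩
  by_cases hd : C.Uses d
  · obtain ⟨i, rfl | h⟩ := hd
    · rw [if_pos (hdart i).1, if_neg (hdart i).2, C.chain_dart, sub_zero]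
    · have hi := hdart i
      rw [h, G.rev_rev] at hi
      rw [if_pos hi.1, if_neg hi.2, ← neg_neg (C.chain d), ← C.chain_rev, ← h, C.chain_dart,
        zero_sub]
  · have e : E.Inside C (E.right d) ↔ E.Inside C (E.right (G.rev d)) := not_congr
      ⟨fun h => Joined.trans h (E.joined_of_not_uses hd),
        fun h => Joined.trans h (E.joined_of_not_uses hd).symm⟩
    rw [C.chain_of_not_uses hd]
    simp only [e, sub_self]

open Classical in
theorem sum_faceCirculation_inside [Fintype D] [Fintype F] (E : G.PlanarEmbedding F)
    (C : G.OrientedCycle) (w : D → ℤ) :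
    ∑ f ∈ E.facesInside C, E.faceCirculation w f =
      ∑ d, w d * (if E.Inside C (E.right d) then 1 else 0) := by
  simp only [facesInside, faceCirculation, mul_ite, mul_one, mul_zero, Finset.sum_filter]
  have e : ∀ f, (if E.Inside C f then ∑ d, (if E.right d = f then w d else 0) else 0) =
      ∑ d, if E.right d = f then (if E.Inside C f then w d else 0) else 0 := fun f => by
    split_ifs <;> simp
  simp only [e]
  rw [Finset.sum_comm]
  simp only [Finset.sum_ite_eq, Finset.mem_univ, if_true]

theorem circulation_eq_sum [Fintype V] [Fintype D] [Fintype F] (E : G.PlanarEmbedding F)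
    (C : G.OrientedCycle) (w : D → ℤ) (hw : G.SkewSymmetric w) (hC : E.IsClockwise C) :
    C.circulation w = ∑ f ∈ E.facesInside C, E.faceCirculation w f := by
  classical
  have h1 := C.sum_mul_chain w
  simp only [Int.cast_id, ← E.indicator_inside_sub C hC, mul_sub, Finset.sum_sub_distrib] at h1
  -- By skew-symmetry the left-face sum is minus the right-face sum, so both sides of `h1` are twice
  -- the desired ones.
  have h2 := G.sum_comp_rev fun d => w d * (if E.Inside C (E.right (G.rev d)) then 1 else 0)
  simp only [G.rev_rev, hw _, neg_mul, Finset.sum_neg_distrib] at h1 h2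
  rw [← h2] at h1
  rw [E.sum_faceCirculation_inside, OrientedCycle.circulation]
  linarith

end PlanarEmbedding

end DartGraph

theorem mainTheorem8 {V D F : Type*} [Fintype V] [Fintype D] [Fintype F]
    (G : DartGraph V D) (E : G.PlanarEmbedding F) (w : D → ℤ) (hw : G.SkewSymmetric w)
    (C : G.OrientedCycle) :
    Xor (E.IsClockwise C) (E.IsClockwise C.reverse) ∧
      (E.IsClockwise C → C.circulation w = ∑ f ∈ E.facesInside C, E.faceCirculation w f) := by
  refine ⟨?_, E.circulation_eq_sum C w hw⟩
  rw [E.isClockwise_iff, E.isClockwise_reverse_iff, E.joined_outer_left_iff, not_not, xor_comm]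
  by_cases h : E.Joined C E.outer (E.right (C.dart 0))
  · exact Or.inl ⟨h, not_not_intro h⟩
  · exact Or.inr ⟨h, h⟩
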